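/- Let $M$ be a matroid of rank $2$ on a finite ground set. Then the $h$-vector of the dual matroid $M^*$ (a matroid of corank $2$) is a pure $O$-sequence. Here, for a matroid $N$ of rank $d$ with $f_{i-1}$ independent sets of size $i$, the $h$-vector $h(N)=(h_0,\dots,h_d)$ is defined by $\sum_{j=0}^d h_j\lambda^j=\sum_{i=0}^d f_{i-1}\lambda^i(1-\lambda)^{d-i}$. An order ideal is a set $\mathcal O$ of monomials, in finitely many variables, that contains every divisor of each of its members; it is pure if all its members that are maximal under divisibility have the same degree. If all members of $\mathcal O$ have degree at most $d$, write $F(\mathcal O)=(F_0,\dots,F_d)$, where $F_i$ is the number of members of degree $i$. A vector $(h_0,\dots,h_d)$ is a pure $O$-sequence if it equals $F(\mathcal O)$ for some pure order ideal $\mathcal O$ (zeros at the end are allowed). More explicitly, let $E_1,\dots,E_t$ be the parallelism classes of $M$ (the maximal sets of non-loops of which no two distinct elements form an independent set), and let $v_1<\dots<v_n$ be any total order on the ground set in which every element of $E_k$ precedes every element of $E_\ell$ whenever $k<\ell$. Each basis $B$ of $M$ can be written $B=\{v_i,v_j\}$ with $v_i\in E_k$, $v_j\in E_\ell$, $k<\ell$;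 put $$a_1(B)=\#\{i'>i: v_{i'}\in E_k\cup\dots\cup E_{\ell-1}\},\qquad a_2(B)=\#\{j'>j: v_{j'}\in E_\ell\cup\dots\cup E_t\},$$ and $\mu_B=x_1^{a_1(B)}x_2^{a_2(B)}$, which is determined by $B$. Call $v_p\notin B$ externally passive in $B$ if there is $v_q\in B$ with $v_q<v_p$ such that $(B\setminus v_q)\cup v_p$ is a basis. Then $a_1(B)$ is the number of externally passive $v$ in $B$ with $v_i<v<v_j$, $a_2(B)$ is the number of those with $v>v_j$, and $a_1(B)+a_2(B)$ is the number of all externally passive elements of $B$. Moreover $\mathcal O=\{\mu_B: B\text{ a basis of }M\}$ is a pure order ideal with $F(\mathcal O)=h(M^*)$. -/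

import Mathlib

open scoped Matroid

namespace MatroidHVector

open Polynomial in
/-- The `h`-polynomial of a finite matroid of rank `d`:
`∑ i ∈ {0, …, d}, f_{i-1} X ^ i (1 - X) ^ (d - i)`, where `f_{i-1}` is the number of
independent sets of size `i`. -/
noncomputable def hPoly {α : Type*} (M : Matroid α) : ℤ[X] :=
  ∑ i ∈ Finset.range (M.eRank.toNat + 1),
    C ({A : Set α | M.Indep A ∧ A.ncard = i}.ncard : ℤ) * X ^ i * (1 - X) ^ (M.eRank.toNat - i)

/-- The `h`-vector `(h_0, …, h_d)` of a finite matroid of rank `d`. -/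
noncomputable def hVector {α : Type*} (M : Matroid α) : Fin (M.eRank.toNat + 1) → ℤ :=
  fun j => (hPoly M).coeff j

/-- A pure order ideal of monomials in the variables `σ`. A monomial is given by its exponent
vector in `σ →₀ ℕ`, so that divisibility of monomials is the order `≤`. -/
structure IsPureOrderIdeal {σ : Type*} (O : Set (σ →₀ ℕ)) : Prop where
  /-- Divisors of members are members. -/
  mem_of_dvd : ∀ μ ∈ O, ∀ ν : σ →₀ ℕ, ν ≤ μ → ν ∈ O
  /-- All members that are maximal under divisibility have the same degree. -/
  pure : ∀ μ ν : σ →₀ ℕ, Maximal (· ∈ O) μ → Maximal (· ∈ O) ν → μ.degree = ν.degree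

/-- `F(O) = (h_0, …, h_d)`: all monomials of `O` have degree at most `d`, and exactly `h_i` of
them have degree `i`, for `i = 0, …, d`. -/
structure HasDegreeCounts {σ : Type*} {d : ℕ} (O : Set (σ →₀ ℕ)) (h : Fin (d + 1) → ℤ) :
    Prop where
  degree_le : ∀ μ ∈ O, μ.degree ≤ d
  finite : O.Finite
  count : ∀ i : Fin (d + 1), ({μ ∈ O | μ.degree = (i : ℕ)}.ncard : ℤ) = h i

/-- `(h_0, …, h_d)` is a pure `O`-sequence. -/
def IsPureOSequence {d : ℕ} (h : Fin (d + 1) → ℤ) : Prop :=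
  ∃ (m : ℕ) (O : Set (Fin m →₀ ℕ)), IsPureOrderIdeal O ∧ HasDegreeCounts O h

/-- The parallelism classes of `M`: the maximal sets of nonloops whose elements are pairwise
parallel. -/
def IsParallelClass {α : Type*} (M : Matroid α) (C : Set α) : Prop :=
  Maximal (fun X : Set α => (∀ e ∈ X, M.IsNonloop e) ∧
    ∀ e ∈ X, ∀ f ∈ X, e ≠ f → ¬ M.Indep {e, f}) C

/-- `v` lists the ground set in increasing order (for some total order on it), `E` lists the
parallelism classes without repetition, and the elements of each class come before those
of all later classes. -/
structure IsClassOrdering {α : Type*} (M : Matroid α) {n t : ℕ} (v : Fin n → α)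
    (E : Fin t → Set α) : Prop where
  injective : Function.Injective v
  range_eq : Set.range v = M.E
  class_injective : Function.Injective E
  class_range_eq : Set.range E = {C : Set α | IsParallelClass M C}
  lt : ∀ k l : Fin t, k < l → ∀ i j : Fin n, v i ∈ E k → v j ∈ E l → i < j

/-- The basis `B` is `{v_i, v_j}` with `v_i ∈ E_k`, `v_j ∈ E_l` and `k < l`. -/
structure IsPresentation {α : Type*} (M : Matroid α) {n t : ℕ} (v : Fin n → α)
    (E : Fin t → Set α) (B : Set α) (i j : Fin n) (k l : Fin t) : Prop where
  isBase : M.IsBase B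
  eq : B = {v i, v j}
  lt : k < l
  left_mem : v i ∈ E k
  right_mem : v j ∈ E l

/-- `a₁ = #{i' > i : v_{i'} ∈ E_k ∪ ⋯ ∪ E_{l-1}}`. -/
noncomputable def a₁ {α : Type*} {n t : ℕ} (v : Fin n → α) (E : Fin t → Set α)
    (i : Fin n) (k l : Fin t) : ℕ :=
  {i' : Fin n | i < i' ∧ ∃ m : Fin t, k ≤ m ∧ m < l ∧ v i' ∈ E m}.ncard

/-- `a₂ = #{j' > j : v_{j'} ∈ E_l ∪ ⋯ ∪ E_t}`. -/
noncomputable def a₂ {α : Type*} {n t : ℕ} (v : Fin n → α) (E : Fin t → Set α)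
    (j : Fin n) (l : Fin t) : ℕ :=
  {j' : Fin n | j < j' ∧ ∃ m : Fin t, l ≤ m ∧ v j' ∈ E m}.ncard

/-- `μ` is the monomial `μ_B = x_1 ^ {a₁(B)} x_2 ^ {a₂(B)}` of the basis `B`
(the variables `x_1, x_2` are indexed by `0, 1 : Fin 2`). -/
def IsBasisMonomial {α : Type*} (M : Matroid α) {n t : ℕ} (v : Fin n → α)
    (E : Fin t → Set α) (B : Set α) (μ : Fin 2 →₀ ℕ) : Prop :=
  ∃ (i j : Fin n) (k l : Fin t), IsPresentation M v E B i j k l ∧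
    μ = Finsupp.single 0 (a₁ v E i k l) + Finsupp.single 1 (a₂ v E j l)

/-- The (indices of the) externally passive elements of the basis `B`, for the order
`v_0 < v_1 < ⋯` of the ground set. -/
def externallyPassive {α : Type*} (M : Matroid α) {n : ℕ} (v : Fin n → α) (B : Set α) :
    Set (Fin n) :=
  {p | v p ∉ B ∧ ∃ q : Fin n, q < p ∧ v q ∈ B ∧ M.IsBase (insert (v p) (B \ {v q}))}

end MatroidHVector

namespace MatroidHVector

/-! Colour every loop 0 and every element of the k-th class by a positive number increasing with k
(`classColor`). Bases become pairs (i, j) of increasing nonzero colours. The first exponent counts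
the elements after i of nonzero colour below that of j; the second counts the nonloops after j. In a
finite linear order, "number of later elements" is a coordinate taking each value below the
cardinality exactly once, so a basis can be recovered from its monomial.

Order ideal (`exists_pairMonomial_eq`): lowering the second exponent moves j up, which only enlarges
the set where i may be chosen, so the first exponent can still be lowered to any prescribed value.
Purity (`exists_le_degree_eq`): moving i and j down as far as possible, with the colour of j fixed,
reaches degree (number of nonloops) - 2.

The h-vector: a set A is independent in the dual iff its complement contains a basis. Let j be the
last nonloop outside A, and i the last element outside A of nonzero colour below that of j. The sets
A giving the basis B form exactly the interval from the passive set of B to the complement of B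
(`existsUnique_colorPair_mem_Icc`). By the binomial theorem (`sum_Icc_X_pow_mul`) this interval
contributes the single term X ^ deg μ_B to the h-polynomial. -/

theorem exists_card_filter_gt_eq {ι : Type*} [LinearOrder ι] (S : Finset ι) :
    ∀ b < S.card, ∃ x ∈ S, (S.filter (x < ·)).card = b := by
  induction S using Finset.induction_on_min with
  | empty => simp
  | insert a S ha ih =>
    intro b hb
    have haS : a ∉ S := fun h => lt_irrefl _ (ha a h)
    rw [Finset.card_insert_of_notMem haS] at hb
    rcases Nat.lt_succ_iff_lt_or_eq.1 hb with hb | rfl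
    · obtain ⟨x, hx, hxb⟩ := ih b hb
      refine ⟨x, Finset.mem_insert_of_mem hx, ?_⟩
      rw [Finset.filter_insert, if_neg (ha x hx).not_gt, hxb]
    · refine ⟨a, Finset.mem_insert_self _ _, ?_⟩
      rw [Finset.filter_insert, if_neg (lt_irrefl a), Finset.filter_true_of_mem ha]

theorem eq_of_card_filter_gt_eq {ι : Type*} [LinearOrder ι] {S : Finset ι} {x y : ι}
    (hx : x ∈ S) (hy : y ∈ S) (h : (S.filter (x < ·)).card = (S.filter (y < ·)).card) :
    x = y := by
  have key : ∀ {x y : ι}, y ∈ S → x < y →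
      (S.filter (y < ·)).card < (S.filter (x < ·)).card := by
    intro x y hy hxy
    refine Finset.card_lt_card ((Finset.ssubset_iff_of_subset ?_).2 ⟨y, by simp [hy, hxy], by simp⟩)
    exact Finset.monotone_filter_right S fun z _ hz => hxy.trans hz
  rcases lt_trichotomy x y with hxy | rfl | hxy
  · exact absurd h (key hy hxy).ne'
  · rfl
  · exact absurd h (key hx hxy).ne

-- Writing each member as R together with a subset of T \ R, the free part sums to (X + (1 - X)) ^
-- |T \ R| = 1.
open Polynomial in
theorem sum_Icc_X_pow_mul {ι : Type*} [DecidableEq ι] {R T : Finset ι} (h : R ⊆ T) :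
    ∑ A ∈ Finset.Icc R T, (X : ℤ[X]) ^ A.card * (1 - X) ^ (T.card - A.card) = X ^ R.card := by
  have hinj : Set.InjOn (R ∪ ·) ((T \ R).powerset : Set (Finset ι)) := by
    intro A hA B hB hAB
    have hA' : Disjoint A R := (Finset.subset_sdiff.1 (Finset.mem_powerset.1 hA)).2
    have hB' : Disjoint B R := (Finset.subset_sdiff.1 (Finset.mem_powerset.1 hB)).2
    have := congrArg (· \ R) hAB
    simpa [Finset.union_sdiff_left, hA'.sdiff_eq_left, hB'.sdiff_eq_left] using this
  rw [Finset.Icc_eq_image_powerset h, Finset.sum_image hinj]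
  have : ∀ A ∈ (T \ R).powerset,
      (X : ℤ[X]) ^ (R ∪ A).card * (1 - X) ^ (T.card - (R ∪ A).card) =
        X ^ R.card * (X ^ A.card * (1 - X) ^ ((T \ R).card - A.card)) := by
    intro A hA
    have hA' : Disjoint A R := (Finset.subset_sdiff.1 (Finset.mem_powerset.1 hA)).2
    rw [Finset.card_union_of_disjoint hA'.symm, Finset.card_sdiff_of_subset h, pow_add, mul_assoc,
      Nat.sub_sub]
  rw [Finset.sum_congr rfl this, ← Finset.mul_sum, Finset.sum_pow_mul_eq_add_pow]
  simp


/-! ### Combinatorics of pairs in a coloured linear order -/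

section Coloring

variable {n : ℕ}

/-- A coloring of `Fin n` by natural numbers that is monotone away from the color `0`. -/
def MonotoneOffZero (c : Fin n → ℕ) : Prop :=
  ∀ p q, c p ≠ 0 → c q ≠ 0 → p ≤ q → c p ≤ c q

/-- The elements of nonzero color. -/
def colored (c : Fin n → ℕ) : Finset (Fin n) :=
  Finset.univ.filter fun p => c p ≠ 0

/-- The elements of nonzero color smaller than `m`. -/
def coloredBelow (c : Fin n → ℕ) (m : ℕ) : Finset (Fin n) :=
  Finset.univ.filter fun p => c p ≠ 0 ∧ c p < m

/-- The pairs of elements of increasing nonzero colors. -/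
def colorPairs (c : Fin n → ℕ) : Finset (Fin n × Fin n) :=
  Finset.univ.filter fun x => c x.1 ≠ 0 ∧ c x.1 < c x.2

/-- The exponent of the first variable in the monomial of a pair. -/
def exponentOne (c : Fin n → ℕ) (x : Fin n × Fin n) : ℕ :=
  ((coloredBelow c (c x.2)).filter (x.1 < ·)).card

/-- The exponent of the second variable in the monomial of a pair. -/
def exponentTwo (c : Fin n → ℕ) (x : Fin n × Fin n) : ℕ :=
  ((colored c).filter (x.2 < ·)).card

/-- The passive elements of a pair. -/
def passiveFinset (c : Fin n → ℕ) (x : Fin n × Fin n) : Finset (Fin n) :=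
  (coloredBelow c (c x.2)).filter (x.1 < ·) ∪ (colored c).filter (x.2 < ·)

/-- The monomial of a pair. -/
noncomputable def pairMonomial (c : Fin n → ℕ) (x : Fin n × Fin n) : Fin 2 →₀ ℕ :=
  Finsupp.single 0 (exponentOne c x) + Finsupp.single 1 (exponentTwo c x)

variable {c : Fin n → ℕ}

@[simp] theorem mem_colored {p : Fin n} : p ∈ colored c ↔ c p ≠ 0 := by simp [colored]

@[simp] theorem mem_coloredBelow {p : Fin n} {m : ℕ} :
    p ∈ coloredBelow c m ↔ c p ≠ 0 ∧ c p < m := by simp [coloredBelow]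

@[simp] theorem mem_colorPairs {x : Fin n × Fin n} :
    x ∈ colorPairs c ↔ c x.1 ≠ 0 ∧ c x.1 < c x.2 := by simp [colorPairs]

theorem mem_passiveFinset {x : Fin n × Fin n} {p : Fin n} :
    p ∈ passiveFinset c x ↔ ((c p ≠ 0 ∧ c p < c x.2) ∧ x.1 < p) ∨ (c p ≠ 0 ∧ x.2 < p) := by
  simp [passiveFinset]

theorem MonotoneOffZero.lt (hc : MonotoneOffZero c) {p q : Fin n} (hp : c p ≠ 0)
    (h : c p < c q) : p < q := by
  by_contra hqp
  exact absurd (hc q p (by lia) hp (not_lt.1 hqp)) (by lia)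

/-- The two parts are disjoint: elements of smaller nonzero colour precede `x.2`. -/
theorem card_passiveFinset (hc : MonotoneOffZero c) (x : Fin n × Fin n) :
    (passiveFinset c x).card = exponentOne c x + exponentTwo c x := by
  refine Finset.card_union_of_disjoint (Finset.disjoint_left.2 fun p hp hp' => ?_)
  simp only [Finset.mem_filter, mem_coloredBelow, mem_colored] at hp hp'
  exact lt_asymm hp'.2 (hc.lt hp.1.1 hp.1.2)

@[simp] theorem pairMonomial_zero (x : Fin n × Fin n) : pairMonomial c x 0 = exponentOne c x := by
  simp [pairMonomial]

@[simp] theorem pairMonomial_one (x : Fin n × Fin n) : pairMonomial c x 1 = exponentTwo c x := by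
  simp [pairMonomial]

theorem degree_pairMonomial (x : Fin n × Fin n) :
    (pairMonomial c x).degree = exponentOne c x + exponentTwo c x := by
  simp [Finsupp.degree_eq_sum]

/-- The second exponent determines j; this fixes the set in which the first exponent is counted, and
so i. -/
theorem pairMonomial_injOn (c : Fin n → ℕ) :
    Set.InjOn (pairMonomial c) (colorPairs c : Set (Fin n × Fin n)) := by
  rintro ⟨i, j⟩ hx ⟨i', j'⟩ hy h
  simp only [Finset.mem_coe, mem_colorPairs] at hx hy
  have h1 : exponentOne c (i, j) = exponentOne c (i', j') := by
    simpa using DFunLike.congr_fun h 0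
  have h2 : exponentTwo c (i, j) = exponentTwo c (i', j') := by
    simpa using DFunLike.congr_fun h 1
  obtain rfl : j = j' := eq_of_card_filter_gt_eq (S := colored c) (by simp; lia)
    (by simp; lia) h2
  obtain rfl : i = i' := eq_of_card_filter_gt_eq (S := coloredBelow c (c j)) (by simpa using hx)
    (by simpa using hy) h1
  rfl

theorem exponentOne_lt {x : Fin n × Fin n} (hx : x ∈ colorPairs c) :
    exponentOne c x < (coloredBelow c (c x.2)).card := by
  refine Finset.card_lt_card ((Finset.ssubset_iff_of_subset (Finset.filter_subset _ _)).2
    ⟨x.1, ?_, by simp⟩)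
  simpa using hx

theorem exists_pairMonomial_eq (hc : MonotoneOffZero c) {x : Fin n × Fin n}
    (hx : x ∈ colorPairs c) {ν : Fin 2 →₀ ℕ} (hν : ν ≤ pairMonomial c x) :
    ∃ y ∈ colorPairs c, pairMonomial c y = ν := by
  obtain ⟨i, j⟩ := x
  have h1 : ν 0 ≤ exponentOne c (i, j) := by simpa using hν 0
  have h2 : ν 1 ≤ exponentTwo c (i, j) := by simpa using hν 1
  have hx' := hx
  simp only [mem_colorPairs] at hx'
  -- Searching only from j onwards keeps the colour of j' at least that of j; it does not affect the
  -- count, since everything after j' is also after j.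
  obtain ⟨j', hj', hj'ν⟩ := exists_card_filter_gt_eq ((colored c).filter (j ≤ ·)) (ν 1) (by
    refine h2.trans_lt (Finset.card_lt_card ((Finset.ssubset_iff_of_subset ?_).2 ⟨j, ?_, ?_⟩))
    · exact Finset.monotone_filter_right _ fun _ _ h => le_of_lt h
    · simp; lia
    · simp)
  simp only [Finset.mem_filter, mem_colored] at hj'
  have hcj : c j ≤ c j' := hc j j' (by lia) hj'.1 hj'.2
  obtain ⟨i', hi', hi'ν⟩ := exists_card_filter_gt_eq (coloredBelow c (c j')) (ν 0) (by
    refine h1.trans_lt ((exponentOne_lt hx).trans_le (Finset.card_le_card fun p hp => ?_))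
    simp only [mem_coloredBelow] at hp ⊢
    exact ⟨hp.1, hp.2.trans_le hcj⟩)
  refine ⟨(i', j'), by simpa using hi', ?_⟩
  ext k
  fin_cases k
  · simpa [exponentOne] using hi'ν
  · simp only [Fin.mk_one, pairMonomial_one, ← hj'ν, exponentTwo, Finset.filter_filter]
    congr 1
    ext p
    simp only [Finset.mem_filter, mem_colored, and_congr_right_iff]
    intro _
    exact ⟨fun h => ⟨hj'.2.trans h.le, h⟩, fun h => h.2⟩

/-- The colour of j splits the coloured elements into S (below) and T (the rest). Taking the first
element of each gives exponents |S| - 1 and |T| - 1. -/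
theorem exists_le_degree_eq (hc : MonotoneOffZero c) {x : Fin n × Fin n}
    (hx : x ∈ colorPairs c) :
    ∃ y ∈ colorPairs c, pairMonomial c x ≤ pairMonomial c y ∧
      (pairMonomial c y).degree + 2 = (colored c).card := by
  obtain ⟨i, j⟩ := x
  simp only [mem_colorPairs] at hx
  set S := coloredBelow c (c j) with hS
  set T := (colored c).filter (c j ≤ c ·) with hT
  have hiS : i ∈ S := by simpa [hS] using hx
  have hjT : j ∈ T := by simp [hT]; lia
  obtain ⟨i', hi', hi'min⟩ := S.exists_min_image id ⟨i, hiS⟩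
  obtain ⟨j', hj', hj'min⟩ := T.exists_min_image id ⟨j, hjT⟩
  simp only [id] at hi'min hj'min
  have hi'' := hi'
  have hj'' := hj'
  simp only [hS, hT, mem_coloredBelow, Finset.mem_filter, mem_colored] at hi'' hj''
  -- The first element of T still has the colour of j, so S is unchanged when j is replaced by j'.
  have hcj : c j' = c j := le_antisymm (hc _ _ hj''.1 (by lia) (hj'min j hjT)) hj''.2
  have hST : S.card + T.card = (colored c).card := by
    rw [← Finset.card_filter_add_card_filter_not (s := colored c) (fun p => c p < c j)]
    congr 2
    · ext p; simp [hS]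
    · ext p; simp [hT]
  have e1 : S.filter (i' < ·) = S.erase i' := by
    ext p
    simp only [Finset.mem_filter, Finset.mem_erase]
    exact ⟨fun h => ⟨h.2.ne', h.1⟩, fun h => ⟨h.2, lt_of_le_of_ne (hi'min p h.2) h.1.symm⟩⟩
  have e2 : (colored c).filter (j' < ·) = T.erase j' := by
    ext p
    simp only [Finset.mem_filter, Finset.mem_erase, hT, mem_colored]
    refine ⟨fun h => ⟨h.2.ne', h.1, hcj ▸ hc _ _ hj''.1 h.1 h.2.le⟩, fun h => ⟨h.2.1, ?_⟩⟩
    exact lt_of_le_of_ne (hj'min p (by simpa [hT] using h.2)) h.1.symm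
  have hy : (i', j') ∈ colorPairs c := by simp [hcj, hi'']
  have d1 : exponentOne c (i', j') + 1 = S.card := by
    simp only [exponentOne, hcj, ← hS, e1]
    exact Finset.card_erase_add_one hi'
  have d2 : exponentTwo c (i', j') + 1 = T.card := by
    simp only [exponentTwo, e2]
    exact Finset.card_erase_add_one hj'
  refine ⟨(i', j'), hy, ?_, by rw [degree_pairMonomial]; lia⟩
  intro k
  fin_cases k
  · simp only [Fin.zero_eta, pairMonomial_zero, exponentOne, hcj]
    exact Finset.card_le_card
      (Finset.monotone_filter_right _ fun _ _ h => (hi'min i hiS).trans_lt h)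
  · simp only [Fin.mk_one, pairMonomial_one, exponentTwo]
    exact Finset.card_le_card
      (Finset.monotone_filter_right _ fun _ _ h => (hj'min j hjT).trans_lt h)

theorem isPureOrderIdeal_pairMonomial (hc : MonotoneOffZero c) :
    IsPureOrderIdeal (pairMonomial c '' (colorPairs c : Set (Fin n × Fin n))) where
  mem_of_dvd := by
    rintro _ ⟨x, hx, rfl⟩ ν hν
    obtain ⟨y, hy, rfl⟩ := exists_pairMonomial_eq hc hx hν
    exact ⟨y, hy, rfl⟩
  pure := by
    have key : ∀ μ : Fin 2 →₀ ℕ,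
        Maximal (· ∈ pairMonomial c '' (colorPairs c : Set (Fin n × Fin n))) μ →
        μ.degree + 2 = (colored c).card := by
      rintro _ ⟨⟨x, hx, rfl⟩, hmax⟩
      obtain ⟨y, hy, hxy, hdeg⟩ := exists_le_degree_eq hc hx
      rwa [le_antisymm hxy (hmax ⟨y, hy, rfl⟩ hxy)]
    intro μ ν hμ hν
    have := key μ hμ
    have := key ν hν
    lia

theorem degree_pairMonomial_le (hc : MonotoneOffZero c) {x : Fin n × Fin n}
    (hx : x ∈ colorPairs c) : (pairMonomial c x).degree ≤ n - 2 := by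
  obtain ⟨y, hy, hxy, hdeg⟩ := exists_le_degree_eq hc hx
  have h1 := Finsupp.degree_mono hxy
  have h2 : (colored c).card ≤ n := by simpa using Finset.card_le_univ (colored c)
  lia

theorem passiveFinset_subset (hc : MonotoneOffZero c) {x : Fin n × Fin n}
    (hx : x ∈ colorPairs c) : passiveFinset c x ⊆ {x.1, x.2}ᶜ := by
  intro p hp
  have hx' := hx
  rw [mem_colorPairs] at hx'
  have := hc.lt hx'.1 hx'.2
  rw [mem_passiveFinset] at hp
  simp only [Finset.mem_compl, Finset.mem_insert, Finset.mem_singleton, not_or]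
  constructor <;> rintro rfl
  · rcases hp with hp | hp
    · exact lt_irrefl _ hp.2
    · exact lt_asymm this hp.2
  · rcases hp with hp | hp
    · exact lt_irrefl _ hp.1.2
    · exact lt_irrefl _ hp.2

/-- The pair is found greedily: the last coloured j outside A, then the last i outside A of smaller
nonzero colour. The choice of i is possible because j has at least the colour of j₀, so i₀ is a
candidate. -/
theorem existsUnique_colorPair_mem_Icc (hc : MonotoneOffZero c) {A : Finset (Fin n)}
    (hA : ∃ x ∈ colorPairs c, x.1 ∉ A ∧ x.2 ∉ A) :
    ∃! x, x ∈ colorPairs c ∧ A ∈ Finset.Icc (passiveFinset c x) {x.1, x.2}ᶜ := by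
  have hsub : ∀ x : Fin n × Fin n, A ⊆ {x.1, x.2}ᶜ ↔ x.1 ∉ A ∧ x.2 ∉ A := by
    intro x
    rw [Finset.subset_compl_comm]
    simp [Finset.insert_subset_iff]
  simp only [Finset.mem_Icc, hsub]
  obtain ⟨⟨i₀, j₀⟩, hx, hi₀, hj₀⟩ := hA
  simp only [mem_colorPairs] at hx hi₀ hj₀
  obtain ⟨j, hj, hjmax⟩ := (colored c \ A).exists_max_image id ⟨j₀, by simp [hj₀]; lia⟩
  have hj0 := hjmax j₀ (by simp [hj₀]; lia)
  simp only [Finset.mem_sdiff, mem_colored, id] at hj hjmax hj0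
  have hcj : c j₀ ≤ c j := hc _ _ (by lia) hj.1 hj0
  obtain ⟨i, hi, himax⟩ := (coloredBelow c (c j) \ A).exists_max_image id
    ⟨i₀, by simp [hi₀]; lia⟩
  simp only [Finset.mem_sdiff, mem_coloredBelow, id] at hi himax
  refine ⟨(i, j), ⟨by simpa using hi.1, fun p hp => ?_, hi.2, hj.2⟩, ?_⟩
  · by_contra hpA
    rw [mem_passiveFinset] at hp
    rcases hp with hp | hp
    · exact absurd (himax p ⟨hp.1, hpA⟩) (not_le.2 hp.2)
    · exact absurd (hjmax p ⟨hp.1, hpA⟩) (not_le.2 hp.2)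
  · rintro ⟨i', j'⟩ ⟨hx', hpass, hi', hj'⟩
    simp only [mem_colorPairs] at hx' hi' hj'
    have hjj : j' = j := by
      -- If j' came before j, then j would be passive for the other pair and hence lie in A. The
      -- same argument applies to i.
      refine le_antisymm (hjmax j' ⟨by lia, hj'⟩) (not_lt.1 fun h => hj.2 (hpass ?_))
      exact mem_passiveFinset.2 (Or.inr ⟨hj.1, h⟩)
    subst hjj
    have hii : i' = i := by
      refine le_antisymm (himax i' ⟨hx', hi'⟩) (not_lt.1 fun h => hi.2 (hpass ?_))
      exact mem_passiveFinset.2 (Or.inl ⟨hi.1, h⟩)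
    rw [hii]

open Polynomial in
theorem sum_X_pow_degree_pairMonomial (hc : MonotoneOffZero c) (D : Finset (Finset (Fin n)))
    (hD : ∀ A, A ∈ D ↔ ∃ x ∈ colorPairs c, x.1 ∉ A ∧ x.2 ∉ A) :
    ∑ A ∈ D, (X : ℤ[X]) ^ A.card * (1 - X) ^ (n - 2 - A.card) =
      ∑ x ∈ colorPairs c, X ^ (pairMonomial c x).degree := by
  have hfib : ∀ x ∈ colorPairs c, (X : ℤ[X]) ^ (pairMonomial c x).degree =
      ∑ A ∈ Finset.Icc (passiveFinset c x) {x.1, x.2}ᶜ,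
        (X : ℤ[X]) ^ A.card * (1 - X) ^ (n - 2 - A.card) := by
    intro x hx
    have hne : x.1 ≠ x.2 := fun h => by rw [mem_colorPairs, h] at hx; exact lt_irrefl _ hx.2
    have hcard : ({x.1, x.2}ᶜ : Finset (Fin n)).card = n - 2 := by
      rw [Finset.card_compl, Finset.card_pair hne, Fintype.card_fin]
    rw [← hcard, sum_Icc_X_pow_mul (passiveFinset_subset hc hx), card_passiveFinset hc,
      degree_pairMonomial]
  rw [Finset.sum_congr rfl hfib, ← Finset.sum_biUnion]
  · refine Finset.sum_congr ?_ fun _ _ => rfl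
    ext A
    rw [hD, Finset.mem_biUnion]
    refine ⟨fun h => (existsUnique_colorPair_mem_Icc hc h).exists, ?_⟩
    rintro ⟨x, hx, hA⟩
    have := (Finset.mem_Icc.1 hA).2
    exact ⟨x, hx, fun h => by simpa using this h, fun h => by simpa using this h⟩
  · intro x hx y hy hxy
    refine Finset.disjoint_left.2 fun A hAx hAy => hxy ?_
    have := (Finset.mem_Icc.1 hAx).2
    exact (existsUnique_colorPair_mem_Icc hc
      ⟨x, hx, fun h => by simpa using this h, fun h => by simpa using this h⟩).unique
      ⟨hx, hAx⟩ ⟨hy, hAy⟩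

end Coloring


/-! ### Parallelism classes and bases in rank 2 -/

variable {α : Type*} {M : Matroid α}

/-- Two nonloops are equal or parallel iff their closures agree, which is an equivalence relation.
Without a nonloop the empty set would be a maximal set of the required kind. -/
theorem isParallelClass_iff (hM : ∃ e, M.IsNonloop e) {C : Set α} :
    IsParallelClass M C ↔
      ∃ e, M.IsNonloop e ∧ C = {f | M.IsNonloop f ∧ M.closure {f} = M.closure {e}} := by
  have hpred : ∀ e : α, (∀ f ∈ {f | M.IsNonloop f ∧ M.closure {f} = M.closure {e}},
      M.IsNonloop f) ∧ ∀ f ∈ {f | M.IsNonloop f ∧ M.closure {f} = M.closure {e}},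
      ∀ g ∈ {f | M.IsNonloop f ∧ M.closure {f} = M.closure {e}}, f ≠ g → ¬ M.Indep {f, g} := by
    refine fun e => ⟨fun f hf => hf.1, fun f hf g hg hfg => ?_⟩
    exact ((hf.1.closure_eq_closure_iff_eq_or_dep hg.1).1 (hf.2.trans hg.2.symm)).resolve_left hfg
  constructor
  · rintro ⟨⟨hnl, hpar⟩, hmax⟩
    obtain ⟨e, he⟩ : C.Nonempty := by
      rw [Set.nonempty_iff_ne_empty]
      rintro rfl
      obtain ⟨e, he⟩ := hM
      exact hmax (hpred e) (Set.empty_subset _) ⟨he, rfl⟩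
    refine ⟨e, hnl e he, ?_⟩
    have hsub : C ⊆ {f | M.IsNonloop f ∧ M.closure {f} = M.closure {e}} := fun f hf =>
      ⟨hnl f hf, ((hnl f hf).closure_eq_closure_iff_eq_or_dep (hnl e he)).2
        (or_iff_not_imp_left.2 fun hne => hpar f hf e he hne)⟩
    exact hsub.antisymm (hmax (hpred e) hsub)
  · rintro ⟨e, he, rfl⟩
    refine ⟨hpred e, fun Y hY hsub f hf => ⟨hY.1 f hf, ?_⟩⟩
    exact ((hY.1 f hf).closure_eq_closure_iff_eq_or_dep he).2
      (or_iff_not_imp_left.2 fun hne => hY.2 f hf e (hsub ⟨he, rfl⟩) hne)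

theorem isBase_pair_iff (hM : M.eRank = 2) {e f : α} :
    M.IsBase {e, f} ↔ M.IsNonloop e ∧ M.IsNonloop f ∧ M.closure {e} ≠ M.closure {f} := by
  constructor
  · intro h
    have he : M.IsNonloop e := h.indep.isNonloop_of_mem (by simp)
    have hf : M.IsNonloop f := h.indep.isNonloop_of_mem (by simp)
    refine ⟨he, hf, fun hcl => ?_⟩
    rcases (he.closure_eq_closure_iff_eq_or_dep hf).1 hcl with rfl | hd
    · have := h.encard_eq_eRank
      rw [hM] at this
      simp at this
    · exact hd h.indep
  · rintro ⟨he, hf, hcl⟩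
    rw [Ne, he.closure_eq_closure_iff_eq_or_dep hf, not_or, not_not] at hcl
    refine hcl.2.isBase_of_eRk_ge (Set.toFinite _) ?_
    rw [hcl.2.eRk_eq_encard, Set.encard_pair hcl.1, hM]

theorem exists_isNonloop_of_eRank_eq_two (hM : M.eRank = 2) : ∃ e, M.IsNonloop e := by
  obtain ⟨B, hB⟩ := M.exists_isBase
  obtain ⟨e, f, -, rfl⟩ := Set.encard_eq_two.1 (hB.encard_eq_eRank.trans hM)
  exact ⟨e, hB.indep.isNonloop_of_mem (by simp)⟩

variable {n t : ℕ} {v : Fin n → α} {E : Fin t → Set α}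

open Classical in
/-- The color of an element is one more than the index of its class, or `0` for a loop. -/
noncomputable def classColor (v : Fin n → α) (E : Fin t → Set α) (p : Fin n) : ℕ :=
  if h : ∃ k, v p ∈ E k then (h.choose : ℕ) + 1 else 0

theorem classColor_ne_zero {p : Fin n} (hp : classColor v E p ≠ 0) :
    ∃ k : Fin t, v p ∈ E k ∧ classColor v E p = k + 1 := by
  unfold classColor at hp ⊢
  split at hp
  · next h => exact ⟨h.choose, h.choose_spec, by rw [dif_pos h]⟩
  · simp at hp

/-! ### From class orderings to colourings -/

namespace IsClassOrdering

theorem class_eq (h : IsClassOrdering M v E) (hM : M.eRank = 2) (k : Fin t) :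
    ∃ e, M.IsNonloop e ∧ E k = {f | M.IsNonloop f ∧ M.closure {f} = M.closure {e}} :=
  (isParallelClass_iff (exists_isNonloop_of_eRank_eq_two hM)).1
    (h.class_range_eq.subset ⟨k, rfl⟩)

theorem isNonloop (h : IsClassOrdering M v E) (hM : M.eRank = 2) {e : α} {k : Fin t}
    (he : e ∈ E k) : M.IsNonloop e := by
  obtain ⟨a, -, hk⟩ := h.class_eq hM k
  exact (hk.subset he).1

theorem closure_eq_iff (h : IsClassOrdering M v E) (hM : M.eRank = 2) {e f : α} {k l : Fin t}
    (he : e ∈ E k) (hf : f ∈ E l) : M.closure {e} = M.closure {f} ↔ k = l := by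
  obtain ⟨a, -, hk⟩ := h.class_eq hM k
  refine ⟨fun hef => h.class_injective ?_, ?_⟩
  · obtain ⟨b, -, hl⟩ := h.class_eq hM l
    rw [hk, hl, ← (hk.subset he).2, ← (hl.subset hf).2, hef]
  · rintro rfl
    rw [(hk.subset he).2, (hk.subset hf).2]

theorem exists_mem_class (h : IsClassOrdering M v E) (hM : M.eRank = 2) {e : α}
    (he : M.IsNonloop e) : ∃ k, e ∈ E k := by
  obtain ⟨k, hk⟩ := h.class_range_eq.superset
    ((isParallelClass_iff (exists_isNonloop_of_eRank_eq_two hM)).2 ⟨e, he, rfl⟩)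
  exact ⟨k, hk ▸ ⟨he, rfl⟩⟩

/-- The classes are disjoint, so the choice made in `classColor` is forced. -/
theorem mem_class_iff (h : IsClassOrdering M v E) (hM : M.eRank = 2) {p : Fin n} {k : Fin t} :
    v p ∈ E k ↔ classColor v E p = k + 1 := by
  constructor
  · intro hp
    have hex : ∃ k, v p ∈ E k := ⟨k, hp⟩
    rw [classColor, dif_pos hex, (h.closure_eq_iff hM hex.choose_spec hp).1 rfl]
  · intro hp
    obtain ⟨l, hl, hlp⟩ := classColor_ne_zero (v := v) (E := E) (p := p) (by lia)
    obtain rfl : l = k := Fin.ext (by lia)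
    exact hl

theorem classColor_ne_zero_iff (h : IsClassOrdering M v E) (hM : M.eRank = 2) {p : Fin n} :
    classColor v E p ≠ 0 ↔ M.IsNonloop (v p) := by
  constructor
  · intro hp
    obtain ⟨k, hk, -⟩ := classColor_ne_zero hp
    exact h.isNonloop hM hk
  · intro hp
    obtain ⟨k, hk⟩ := h.exists_mem_class hM hp
    rw [(h.mem_class_iff hM).1 hk]
    exact Nat.succ_ne_zero _

theorem monotoneOffZero (h : IsClassOrdering M v E) : MonotoneOffZero (classColor v E) := by
  intro p q hp hq hpq
  obtain ⟨k, hk, hkp⟩ := classColor_ne_zero hp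
  obtain ⟨l, hl, hlq⟩ := classColor_ne_zero hq
  rw [hkp, hlq]
  by_contra hlt
  exact absurd (h.lt l k (by lia) q p hl hk) (not_lt.2 hpq)

theorem isBase_pair_iff (h : IsClassOrdering M v E) (hM : M.eRank = 2) {p q : Fin n} :
    M.IsBase {v p, v q} ↔
      classColor v E p ≠ 0 ∧ classColor v E q ≠ 0 ∧ classColor v E p ≠ classColor v E q := by
  rw [MatroidHVector.isBase_pair_iff hM, h.classColor_ne_zero_iff hM, h.classColor_ne_zero_iff hM]
  refine and_congr_right fun hp => and_congr_right fun hq => not_congr ?_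
  obtain ⟨k, hk⟩ := h.exists_mem_class hM hp
  obtain ⟨l, hl⟩ := h.exists_mem_class hM hq
  rw [h.closure_eq_iff hM hk hl, (h.mem_class_iff hM).1 hk, (h.mem_class_iff hM).1 hl]
  lia

theorem exists_eq_pair (h : IsClassOrdering M v E) (hM : M.eRank = 2) {B : Set α}
    (hB : M.IsBase B) : ∃ x ∈ colorPairs (classColor v E), B = {v x.1, v x.2} := by
  obtain ⟨e, f, hne, rfl⟩ := Set.encard_eq_two.1 (hB.encard_eq_eRank.trans hM)
  obtain ⟨p, rfl⟩ := h.range_eq.superset (hB.subset_ground (Set.mem_insert e {f}))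
  obtain ⟨q, rfl⟩ := h.range_eq.superset (hB.subset_ground (Set.mem_insert_of_mem _ rfl))
  obtain ⟨hp, hq, hpq⟩ := (h.isBase_pair_iff hM).1 hB
  rcases lt_or_gt_of_ne hpq with hlt | hlt
  · exact ⟨(p, q), by simp [hp, hlt], rfl⟩
  · exact ⟨(q, p), by simp [hq, hlt], Set.pair_comm _ _⟩

theorem isBase_of_mem_colorPairs (h : IsClassOrdering M v E) (hM : M.eRank = 2)
    {x : Fin n × Fin n} (hx : x ∈ colorPairs (classColor v E)) : M.IsBase {v x.1, v x.2} := by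
  rw [mem_colorPairs] at hx
  exact (h.isBase_pair_iff hM).2 ⟨hx.1, by lia, by lia⟩

theorem pair_injective (h : IsClassOrdering M v E) {x y : Fin n × Fin n}
    (hx : x ∈ colorPairs (classColor v E)) (hy : y ∈ colorPairs (classColor v E))
    (hxy : ({v x.1, v x.2} : Set α) = {v y.1, v y.2}) : x = y := by
  rw [mem_colorPairs] at hx hy
  have hx' := h.monotoneOffZero.lt hx.1 hx.2
  have hy' := h.monotoneOffZero.lt hy.1 hy.2
  rw [Set.pair_eq_pair_iff] at hxy
  rcases hxy with ⟨h1, h2⟩ | ⟨h1, h2⟩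
  · exact Prod.ext (h.injective h1) (h.injective h2)
  · rw [h.injective h1, h.injective h2] at hx'
    exact absurd hx' hy'.not_gt

theorem isPresentation_iff (h : IsClassOrdering M v E) (hM : M.eRank = 2) {B : Set α}
    {i j : Fin n} {k l : Fin t} : IsPresentation M v E B i j k l ↔
      B = {v i, v j} ∧ classColor v E i = k + 1 ∧ classColor v E j = l + 1 ∧ k < l := by
  constructor
  · intro hP
    exact ⟨hP.eq, (h.mem_class_iff hM).1 hP.left_mem, (h.mem_class_iff hM).1 hP.right_mem, hP.lt⟩
  · rintro ⟨rfl, hi, hj, hkl⟩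
    refine ⟨(h.isBase_pair_iff hM).2 ⟨by lia, by lia, ?_⟩, rfl, hkl,
      (h.mem_class_iff hM).2 hi, (h.mem_class_iff hM).2 hj⟩
    rw [hi, hj]
    lia

theorem a₁_eq (h : IsClassOrdering M v E) (hM : M.eRank = 2) {i j : Fin n} {k l : Fin t}
    (hi : classColor v E i = k + 1) (hj : classColor v E j = l + 1) :
    a₁ v E i k l = exponentOne (classColor v E) (i, j) := by
  rw [a₁, exponentOne, ← Set.ncard_coe_finset]
  congr 1
  ext p
  simp only [Set.mem_ofPred_eq, Finset.coe_filter, mem_coloredBelow, h.mem_class_iff hM]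
  constructor
  · rintro ⟨hip, m, hkm, hml, hp⟩
    exact ⟨⟨by lia, by lia⟩, hip⟩
  · rintro ⟨⟨hp, hpl⟩, hip⟩
    obtain ⟨m, -, hm⟩ := classColor_ne_zero hp
    -- The lower bound k ≤ m is automatic for nonloops after i, which is why `exponentOne` omits it.
    have := h.monotoneOffZero i p (by lia) hp hip.le
    exact ⟨hip, m, by lia, by lia, hm⟩

theorem a₂_eq (h : IsClassOrdering M v E) (hM : M.eRank = 2) {i j : Fin n} {l : Fin t}
    (hj : classColor v E j = l + 1) :
    a₂ v E j l = exponentTwo (classColor v E) (i, j) := by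
  rw [a₂, exponentTwo, ← Set.ncard_coe_finset]
  congr 1
  ext p
  simp only [Set.mem_ofPred_eq, Finset.coe_filter, mem_colored, h.mem_class_iff hM]
  constructor
  · rintro ⟨hip, m, hkm, hp⟩
    exact ⟨by lia, hip⟩
  · rintro ⟨hp, hjp⟩
    obtain ⟨m, -, hm⟩ := classColor_ne_zero hp
    have := h.monotoneOffZero j p (by lia) hp hjp.le
    exact ⟨hjp, m, by lia, hm⟩

theorem isBasisMonomial_iff (h : IsClassOrdering M v E) (hM : M.eRank = 2) {B : Set α}
    {μ : Fin 2 →₀ ℕ} : IsBasisMonomial M v E B μ ↔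
      ∃ x ∈ colorPairs (classColor v E), B = {v x.1, v x.2} ∧
        μ = pairMonomial (classColor v E) x := by
  constructor
  · rintro ⟨i, j, k, l, hP, rfl⟩
    obtain ⟨rfl, hi, hj, hkl⟩ := (h.isPresentation_iff hM).1 hP
    refine ⟨(i, j), by simp only [mem_colorPairs]; lia, rfl, ?_⟩
    rw [pairMonomial, h.a₁_eq hM hi hj, h.a₂_eq hM hj]
  · rintro ⟨⟨i, j⟩, hx, rfl, rfl⟩
    rw [mem_colorPairs] at hx
    obtain ⟨k, -, hk⟩ := classColor_ne_zero hx.1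
    obtain ⟨l, -, hl⟩ := classColor_ne_zero (v := v) (E := E) (p := j) (by lia)
    refine ⟨i, j, k, l, (h.isPresentation_iff hM).2 ⟨rfl, hk, hl, by lia⟩, ?_⟩
    rw [pairMonomial, h.a₁_eq hM hk hl, h.a₂_eq hM hl]

theorem setOf_isBasisMonomial (h : IsClassOrdering M v E) (hM : M.eRank = 2) :
    {μ | ∃ B : Set α, M.IsBase B ∧ IsBasisMonomial M v E B μ} =
      pairMonomial (classColor v E) '' (colorPairs (classColor v E) : Set (Fin n × Fin n)) := by
  ext μ
  simp only [h.isBasisMonomial_iff hM, Set.mem_ofPred_eq, Set.mem_image, Finset.mem_coe]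
  constructor
  · rintro ⟨B, -, x, hx, -, rfl⟩
    exact ⟨x, hx, rfl⟩
  · rintro ⟨x, hx, rfl⟩
    exact ⟨_, h.isBase_of_mem_colorPairs hM hx, x, hx, rfl, rfl⟩

theorem existsUnique_isBasisMonomial (h : IsClassOrdering M v E) (hM : M.eRank = 2) {B : Set α}
    (hB : M.IsBase B) : ∃! μ : Fin 2 →₀ ℕ, IsBasisMonomial M v E B μ := by
  obtain ⟨x, hx, rfl⟩ := h.exists_eq_pair hM hB
  refine ⟨pairMonomial _ x, (h.isBasisMonomial_iff hM).2 ⟨x, hx, rfl, rfl⟩, fun μ hμ => ?_⟩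
  obtain ⟨y, hy, hxy, rfl⟩ := (h.isBasisMonomial_iff hM).1 hμ
  rw [h.pair_injective hx hy hxy]

/-- Exchanging i for a later p requires p to be a nonloop not of the colour of j: it is either of
smaller colour, or of larger colour and then after j. Exchanging j for a later nonloop p always
works, since p has at least the colour of j. -/
theorem externallyPassive_eq (h : IsClassOrdering M v E) (hM : M.eRank = 2) {i j : Fin n}
    (hx : (i, j) ∈ colorPairs (classColor v E)) :
    externallyPassive M v {v i, v j} = passiveFinset (classColor v E) (i, j) := by
  rw [mem_colorPairs] at hx
  have hij : i < j := h.monotoneOffZero.lt hx.1 hx.2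
  have hvij : v i ≠ v j := fun he => hij.ne (h.injective he)
  have hlt : ∀ {p q : Fin n}, classColor v E p ≠ 0 → classColor v E p < classColor v E q → p < q :=
    fun hp hpq => h.monotoneOffZero.lt hp hpq
  have hbi : ∀ p, M.IsBase (insert (v p) ({v i, v j} \ {v i})) ↔ classColor v E p ≠ 0 ∧
      classColor v E j ≠ 0 ∧ classColor v E p ≠ classColor v E j := by
    intro p
    rw [Set.pair_sdiff_left hvij, h.isBase_pair_iff hM]
  have hbj : ∀ p, M.IsBase (insert (v p) ({v i, v j} \ {v j})) ↔ classColor v E p ≠ 0 ∧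
      classColor v E i ≠ 0 ∧ classColor v E p ≠ classColor v E i := by
    intro p
    rw [Set.pair_sdiff_right hvij, h.isBase_pair_iff hM]
  ext p
  simp only [externallyPassive, Set.mem_ofPred_eq, Finset.mem_coe, mem_passiveFinset,
    Set.mem_insert_iff, Set.mem_singleton_iff, h.injective.eq_iff, not_or]
  constructor
  · rintro ⟨⟨hpi, hpj⟩, q, hqp, rfl | rfl, hb⟩
    · obtain ⟨hp, -, hne⟩ := (hbi p).1 hb
      rcases lt_or_gt_of_ne hne with hlt' | hlt'
      · exact Or.inl ⟨⟨hp, hlt'⟩, hqp⟩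
      · exact Or.inr ⟨hp, hlt (by lia) hlt'⟩
    · exact Or.inr ⟨((hbj p).1 hb).1, hqp⟩
  · rintro (⟨⟨hp, hpj⟩, hip⟩ | ⟨hp, hjp⟩)
    · exact ⟨⟨hip.ne', (hlt hp hpj).ne⟩, i, hip, Or.inl rfl, (hbi p).2 ⟨hp, by lia, hpj.ne⟩⟩
    · have := h.monotoneOffZero j p (by lia) hp hjp.le
      exact ⟨⟨(hij.trans hjp).ne', hjp.ne'⟩, j, hjp, Or.inr rfl,
        (hbj p).2 ⟨hp, hx.1, by lia⟩⟩

theorem exponents_eq_ncard (h : IsClassOrdering M v E) (hM : M.eRank = 2) {B : Set α}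
    {i j : Fin n} {k l : Fin t} (hP : IsPresentation M v E B i j k l) :
    a₁ v E i k l = (externallyPassive M v B ∩ Set.Ioo i j).ncard ∧
      a₂ v E j l = (externallyPassive M v B ∩ Set.Ioi j).ncard ∧
      a₁ v E i k l + a₂ v E j l = (externallyPassive M v B).ncard := by
  obtain ⟨rfl, hi, hj, hkl⟩ := (h.isPresentation_iff hM).1 hP
  have hx : (i, j) ∈ colorPairs (classColor v E) := by rw [mem_colorPairs]; lia
  have hx' := mem_colorPairs.1 hx
  have hij : i < j := h.monotoneOffZero.lt hx'.1 hx'.2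
  rw [h.externallyPassive_eq hM hx, h.a₁_eq hM hi hj, h.a₂_eq (i := i) hM hj]
  refine ⟨?_, ?_, ?_⟩
  · rw [exponentOne, ← Set.ncard_coe_finset]
    congr 1
    ext p
    simp only [Finset.coe_filter, mem_coloredBelow, Set.mem_ofPred_eq, Set.mem_inter_iff,
      Finset.mem_coe, mem_passiveFinset, Set.mem_Ioo]
    constructor
    · rintro ⟨hp, hip⟩
      exact ⟨Or.inl ⟨hp, hip⟩, hip, h.monotoneOffZero.lt hp.1 hp.2⟩
    · rintro ⟨hp | hp, hip, hpj⟩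
      · exact hp
      · exact absurd hpj hp.2.not_gt
  · rw [exponentTwo, ← Set.ncard_coe_finset]
    congr 1
    ext p
    simp only [Finset.coe_filter, mem_colored, Set.mem_ofPred_eq, Set.mem_inter_iff,
      Finset.mem_coe, mem_passiveFinset, Set.mem_Ioi]
    constructor
    · rintro ⟨hp, hjp⟩
      exact ⟨Or.inr ⟨hp, hjp⟩, hjp⟩
    · rintro ⟨hp | hp, hjp⟩
      · exact ⟨hp.1.1, hjp⟩
      · exact hp
  · rw [Set.ncard_coe_finset, card_passiveFinset h.monotoneOffZero]

/-! ### The h-vector of the dual matroid -/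

theorem toNat_eRank_dual (h : IsClassOrdering M v E) (hM : M.eRank = 2) :
    M✶.eRank.toNat = n - 2 := by
  have h1 := M.eRank_add_eRank_dual
  have h2 : M.E.encard = n := by
    rw [← h.range_eq, ← Set.image_univ, h.injective.encard_image]
    simp
  rw [hM, h2] at h1
  have h3 : M✶.eRank ≠ ⊤ := by
    intro htop
    rw [htop] at h1
    simp at h1
  lift M✶.eRank to ℕ using h3 with r
  have : 2 + r = n := by exact_mod_cast h1
  simp
  lia

theorem dual_indep_image_iff (h : IsClassOrdering M v E) (hM : M.eRank = 2)
    {A : Finset (Fin n)} : M✶.Indep (v '' A) ↔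
      ∃ x ∈ colorPairs (classColor v E), x.1 ∉ A ∧ x.2 ∉ A := by
  rw [Matroid.dual_indep_iff_exists', and_iff_right
    ((Set.image_subset_range _ _).trans h.range_eq.subset)]
  have hdisj : ∀ p q, Disjoint (v '' A) {v p, v q} ↔ p ∉ A ∧ q ∉ A := by
    intro p q
    rw [← Set.image_pair, Set.disjoint_image_iff h.injective]
    simp [Set.disjoint_insert_right]
  constructor
  · rintro ⟨B, hB, hd⟩
    obtain ⟨x, hx, rfl⟩ := h.exists_eq_pair hM hB
    exact ⟨x, hx, (hdisj _ _).1 hd⟩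
  · rintro ⟨x, hx, hd⟩
    exact ⟨_, h.isBase_of_mem_colorPairs hM hx, (hdisj _ _).2 hd⟩

open Polynomial Classical in
theorem hPoly_dual (h : IsClassOrdering M v E) (hM : M.eRank = 2) :
    hPoly M✶ = ∑ x ∈ colorPairs (classColor v E),
      X ^ (pairMonomial (classColor v E) x).degree := by
  set D : Finset (Finset (Fin n)) := Finset.univ.filter fun A => M✶.Indep (v '' A) with hDdef
  have hD : ∀ A, A ∈ D ↔ ∃ x ∈ colorPairs (classColor v E), x.1 ∉ A ∧ x.2 ∉ A := by
    intro A
    rw [hDdef, Finset.mem_filter, and_iff_right (Finset.mem_univ A), h.dual_indep_image_iff hM]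
  rw [← sum_X_pow_degree_pairMonomial h.monotoneOffZero D hD, hPoly, h.toNat_eRank_dual hM]
  -- Independent sets lie in the ground set, the range of the injective `v`, so they correspond to
  -- finsets of indices of the same size.
  have hcount : ∀ i : ℕ, {A : Set α | M✶.Indep A ∧ A.ncard = i}.ncard =
      (D.filter fun A => A.card = i).card := by
    intro i
    rw [← Set.ncard_coe_finset, ← Set.InjOn.ncard_image (f := fun A : Finset (Fin n) => v '' A)]
    · congr 1
      ext A
      simp only [Set.mem_ofPred_eq, Set.mem_image, Finset.mem_coe, Finset.mem_filter]
      constructor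
      · rintro ⟨hA, hi⟩
        have hsub : A ⊆ Set.range v := by rw [h.range_eq]; exact hA.subset_ground
        obtain ⟨A, rfl⟩ := Set.subset_range_iff_exists_image_eq.1 hsub
        refine ⟨A.toFinset, ?_⟩
        rw [Set.ncard_image_of_injective _ h.injective, Set.ncard_eq_toFinset_card'] at hi
        simpa [hDdef, hi] using hA
      · rintro ⟨A, ⟨hA, hi⟩, rfl⟩
        rw [Set.ncard_image_of_injective _ h.injective, Set.ncard_coe_finset]
        exact ⟨(Finset.mem_filter.1 hA).2, hi⟩
    · intro A _ A' _ hAA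
      exact Finset.coe_injective (h.injective.image_injective hAA)
  -- Each such set misses two distinct indices, so grouping by size up to n - 2 loses nothing.
  have hmaps : ∀ A ∈ D, A.card ∈ Finset.range (n - 2 + 1) := by
    intro A hA
    obtain ⟨x, hx, h1, h2⟩ := (hD A).1 hA
    rw [mem_colorPairs] at hx
    have hne : x.1 ≠ x.2 := fun he => by rw [he] at hx; exact lt_irrefl _ hx.2
    have hsub : A ⊆ {x.1, x.2}ᶜ := by
      rw [Finset.subset_compl_comm]
      simp [Finset.insert_subset_iff, h1, h2]
    have := Finset.card_le_card hsub
    rw [Finset.card_compl, Finset.card_pair hne, Fintype.card_fin] at this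
    exact Finset.mem_range.2 (Nat.lt_succ_of_le this)
  rw [← Finset.sum_fiberwise_of_maps_to hmaps]
  refine Finset.sum_congr rfl fun i _ => ?_
  rw [hcount, Finset.sum_congr rfl (g := fun _ => (X : ℤ[X]) ^ i * (1 - X) ^ (n - 2 - i))]
  · rw [Finset.sum_const, nsmul_eq_mul, mul_assoc]
    simp
  · intro A hA
    rw [(Finset.mem_filter.1 hA).2]

/-- Since distinct pairs have distinct monomials, counting monomials of degree i is counting pairs,
which is the coefficient read off from `hPoly_dual`. -/
theorem hasDegreeCounts (h : IsClassOrdering M v E) (hM : M.eRank = 2) :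
    HasDegreeCounts
      (pairMonomial (classColor v E) '' (colorPairs (classColor v E) : Set (Fin n × Fin n)))
      (hVector M✶) where
  degree_le := by
    rintro _ ⟨x, hx, rfl⟩
    rw [h.toNat_eRank_dual hM]
    exact degree_pairMonomial_le h.monotoneOffZero hx
  finite := (Finset.finite_toSet _).image _
  count := by
    intro i
    have himage : {μ ∈ pairMonomial (classColor v E) ''
        (colorPairs (classColor v E) : Set (Fin n × Fin n)) | μ.degree = (i : ℕ)} =
        pairMonomial (classColor v E) '' ((colorPairs (classColor v E)).filter
          fun x => (pairMonomial (classColor v E) x).degree = (i : ℕ) :) := by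
      ext μ
      simp only [Set.mem_ofPred_eq, Set.mem_image, Finset.mem_coe, Finset.mem_filter]
      constructor
      · rintro ⟨⟨x, hx, rfl⟩, hi⟩
        exact ⟨x, ⟨hx, hi⟩, rfl⟩
      · rintro ⟨x, ⟨hx, hi⟩, rfl⟩
        exact ⟨⟨x, hx, rfl⟩, hi⟩
    rw [himage, Set.InjOn.ncard_image ((pairMonomial_injOn _).mono
      (Finset.coe_subset.2 (Finset.filter_subset _ _))), Set.ncard_coe_finset, hVector,
      h.hPoly_dual hM, Polynomial.finsetSum_coeff]
    simp [Polynomial.coeff_X_pow, eq_comm]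

end IsClassOrdering

/-! ### Existence of a class ordering -/

theorem exists_isClassOrdering [M.Finite] (hM : M.eRank = 2) :
    ∃ (n t : ℕ) (v : Fin n → α) (E : Fin t → Set α), IsClassOrdering M v E := by
  have hfin : {C : Set α | IsParallelClass M C}.Finite := by
    refine M.ground_finite.finite_subsets.subset fun C hC e he => ?_
    exact ((show IsParallelClass M C from hC).prop.1 e he).mem_ground
  have := hfin.to_subtype
  have := M.ground_finite.to_subtype
  obtain ⟨t, ⟨g⟩⟩ := Finite.exists_equiv_fin {C : Set α | IsParallelClass M C}
  obtain ⟨n, ⟨f⟩⟩ := Finite.exists_equiv_fin M.E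
  set E : Fin t → Set α := fun k => g.symm k with hE
  have hEpar : ∀ k, IsParallelClass M (E k) := fun k => (g.symm k).2
  have hEinj : Function.Injective E := Subtype.val_injective.comp g.symm.injective
  have hdisj : ∀ {e k l}, e ∈ E k → e ∈ E l → k = l := by
    intro e k l hk hl
    obtain ⟨a, -, ha⟩ := (isParallelClass_iff (exists_isNonloop_of_eRank_eq_two hM)).1 (hEpar k)
    obtain ⟨b, -, hb⟩ := (isParallelClass_iff (exists_isNonloop_of_eRank_eq_two hM)).1 (hEpar l)
    refine hEinj ?_
    rw [ha, hb, ← (ha.subset hk).2, ← (hb.subset hl).2]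
  set w : Fin n → α := fun p => f.symm p with hw
  set c : Fin n → ℕ := classColor w E with hc
  have hcE : ∀ {p k}, w p ∈ E k → c p = k + 1 := by
    intro p k hp
    have hex : ∃ k, w p ∈ E k := ⟨k, hp⟩
    rw [hc, classColor, dif_pos hex, hdisj hex.choose_spec hp]
  -- Any enumeration of the ground set, sorted by colour, is a class ordering; loops, of colour 0,
  -- go to the front.
  refine ⟨n, t, w ∘ Tuple.sort c, E, ?_, ?_, hEinj, ?_, ?_⟩
  · exact (Subtype.val_injective.comp f.symm.injective).comp (Equiv.injective _)
  · rw [(Tuple.sort c).surjective.range_comp, hw]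
    exact (f.symm.surjective.range_comp Subtype.val).trans Subtype.range_coe
  · exact (g.symm.surjective.range_comp Subtype.val).trans Subtype.range_coe
  · intro k l hkl i j hi hj
    by_contra hij
    have hmono := Tuple.monotone_sort c (not_lt.1 hij)
    simp only [Function.comp_apply] at hmono hi hj
    rw [hcE hi, hcE hj] at hmono
    lia

end MatroidHVector

theorem mainTheorem2 {α : Type*} (M : Matroid α) [M.Finite] (hM : M.eRank = 2) :
    MatroidHVector.IsPureOSequence (MatroidHVector.hVector M✶) ∧
    ∀ (n t : ℕ) (v : Fin n → α) (E : Fin t → Set α), MatroidHVector.IsClassOrdering M v E →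
      (∀ B : Set α, M.IsBase B → ∃! μ : Fin 2 →₀ ℕ, MatroidHVector.IsBasisMonomial M v E B μ) ∧
      (∀ (B : Set α) (i j : Fin n) (k l : Fin t),
        MatroidHVector.IsPresentation M v E B i j k l →
          MatroidHVector.a₁ v E i k l =
            (MatroidHVector.externallyPassive M v B ∩ Set.Ioo i j).ncard ∧
          MatroidHVector.a₂ v E j l =
            (MatroidHVector.externallyPassive M v B ∩ Set.Ioi j).ncard ∧
          MatroidHVector.a₁ v E i k l + MatroidHVector.a₂ v E j l =
            (MatroidHVector.externallyPassive M v B).ncard) ∧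
      MatroidHVector.IsPureOrderIdeal
        {μ | ∃ B : Set α, M.IsBase B ∧ MatroidHVector.IsBasisMonomial M v E B μ} ∧
      MatroidHVector.HasDegreeCounts
        {μ | ∃ B : Set α, M.IsBase B ∧ MatroidHVector.IsBasisMonomial M v E B μ}
        (MatroidHVector.hVector M✶) := by
  refine ⟨?_, fun n t v E h => ⟨fun B hB => h.existsUnique_isBasisMonomial hM hB,
    fun B i j k l hP => h.exponents_eq_ncard hM hP, ?_, ?_⟩⟩
  · obtain ⟨n, t, v, E, h⟩ := MatroidHVector.exists_isClassOrdering hM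
    exact ⟨2, _, MatroidHVector.isPureOrderIdeal_pairMonomial h.monotoneOffZero,
      h.hasDegreeCounts hM⟩
  · rw [h.setOf_isBasisMonomial hM]
    exact MatroidHVector.isPureOrderIdeal_pairMonomial h.monotoneOffZero
  · rw [h.setOf_isBasisMonomial hM]
    exact h.hasDegreeCounts hM
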